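/- Let $F$ be an algebraically closed field (of any characteristic) and let $d \ge 2$ be an integer with smallest prime divisor $l$. Call $f \in F[x]$ decomposable if $f = g \circ h$ for some $g, h \in F[x]$ with $\deg g \ge 2$ and $\deg h \ge 2$. Let $P_d$ be the space of polynomials in $F[x]$ of degree at most $d$, identified with the affine space $F^{d+1}$ through the coefficients and given the Zariski topology, and let $D_d \subseteq P_d$ be the set of decomposable polynomials of degree exactly $d$. If $d$ is prime, then $D_d = \varnothing$. Otherwise, $\dim D_d = l + d/l$, where $\dim$ denotes the Krull dimension of $D_d$ as a topological subspace of $P_d$. -/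

import Mathlib

namespace DecomposablePolynomials

/-- The set of common zeros in affine space `σ → F` of a set of polynomials over `F`. -/
def zeroSet {σ F : Type*} [Field F] (S : Set (MvPolynomial σ F)) : Set (σ → F) :=
  {x | ∀ p ∈ S, MvPolynomial.eval x p = 0}

/-- The Zariski topology on the affine space `σ → F`: the closed sets are the sets of common
zeros of sets of polynomials. -/
abbrev zariskiTopology (σ F : Type*) [Field F] : TopologicalSpace (σ → F) :=
  TopologicalSpace.ofClosed {Z | ∃ S : Set (MvPolynomial σ F), Z = zeroSet S}
    ⟨{1}, by ext x; simp [zeroSet]⟩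
    (by
      intro A hA
      refine ⟨{p | ∃ Z ∈ A, ∀ x ∈ Z, MvPolynomial.eval x p = 0}, ?_⟩
      ext x
      constructor
      · rintro hx p ⟨Z, hZ, hp⟩
        exact hp x (hx Z hZ)
      · intro hx Z hZ
        obtain ⟨S, rfl⟩ := hA hZ
        exact fun p hp => hx p ⟨_, hZ, fun y hy => hy p hp⟩)
    (by
      rintro _ ⟨S, rfl⟩ _ ⟨T, rfl⟩
      refine ⟨{r | ∃ p ∈ S, ∃ q ∈ T, r = p * q}, ?_⟩
      ext x
      constructor
      · rintro (hx | hx) _ ⟨p, hp, q, hq, rfl⟩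
        · simp [hx p hp]
        · simp [hx q hq]
      · intro hx
        by_contra hcon
        simp only [Set.mem_union, not_or, zeroSet, Set.mem_ofPred_eq, not_forall] at hcon
        obtain ⟨⟨p, hp, hpx⟩, q, hq, hqx⟩ := hcon
        have h := hx (p * q) ⟨p, hp, q, hq, rfl⟩
        rw [map_mul, mul_eq_zero] at h
        exact h.elim hpx hqx)

/-- The coefficient vector `(f₀, …, f_d)` of a polynomial `f` of degree at most `d`. -/
def coeffVector {F : Type*} [Field F] (d : ℕ) (f : Polynomial.degreeLE F (d : WithBot ℕ)) :
    Fin (d + 1) → F :=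
  fun i => (f : Polynomial F).coeff i

/-- The Zariski topology on the space `P_d` of polynomials of degree at most `d`, which is
identified with affine `(d + 1)`-space by taking coefficients. -/
abbrev zariskiTopologyDegreeLE (F : Type*) [Field F] (d : ℕ) :
    TopologicalSpace (Polynomial.degreeLE F (d : WithBot ℕ)) :=
  TopologicalSpace.induced (coeffVector d) (zariskiTopology (Fin (d + 1)) F)

/-- The dimension of a subset of `P_d`: its Krull dimension as a topological space, for the
subspace topology of the Zariski topology on `P_d`. -/
noncomputable def zariskiDim {F : Type*} [Field F] {d : ℕ}
    (D : Set (Polynomial.degreeLE F (d : WithBot ℕ))) : WithBot ℕ∞ :=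
  @topologicalKrullDim D
    (TopologicalSpace.induced Subtype.val (zariskiTopologyDegreeLE F d))

/-- A polynomial is decomposable if it is a composition `g ∘ h` with `deg g, deg h ≥ 2`. -/
def IsDecomposable {F : Type*} [Field F] (f : Polynomial F) : Prop :=
  ∃ g h : Polynomial F, 2 ≤ g.natDegree ∧ 2 ≤ h.natDegree ∧ f = g.comp h

/-- The set `D_d` of decomposable polynomials of degree exactly `d`, as a subset of `P_d`. -/
def decomposables (F : Type*) [Field F] (d : ℕ) :
    Set (Polynomial.degreeLE F (d : WithBot ℕ)) :=
  {f | (f : Polynomial F).degree = (d : WithBot ℕ) ∧ IsDecomposable (f : Polynomial F)}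

end DecomposablePolynomials

/-! Moving an affine map from `h` to `g` makes `h` monic without constant term. For degrees `e` and
`k + 1` with `d = e * (k + 1)`, this leaves `e + 1` coefficients of `g` and `k` of `h`. So `D_d` is
covered by finitely many images of affine spaces of dimension `e + (k + 1)`, and this sum is largest
at `e = l` (`add_div_le_minFac_add_div`). An image cannot exceed its source in dimension, by Noether
normalization and transcendence degree (`topologicalKrullDim_le_of_param`).

For the lower bound, the parametrization is generically finite in every characteristic
(`isAlgebraic_of_coeff_comp_mem`): `h` divides `g ∘ h - g(0)`, so its coefficients are algebraic
over those of `g ∘ h`, and then so are those of `g`. Hence a flag of linear subspaces through a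
general parameter point gives a strict chain of irreducible closed subsets of `D_d`
(`le_topologicalKrullDim_of_param`). -/

/-! ### Algebraicity and Krull dimension in commutative rings. -/

open Polynomial in
/-- The coefficients of a monic divisor of a polynomial over a subring are algebraic over it. -/
theorem isAlgebraic_coeff_of_dvd {A R : Type*} [CommRing A] [IsDomain A] [CommRing R] [IsDomain R]
    [Algebra A R] [FaithfulSMul A R] {p : A[X]} (hp : p ≠ 0) {h : R[X]} (hh : h.Monic)
    (hdvd : h ∣ p.map (algebraMap A R)) (i : ℕ) : IsAlgebraic A (h.coeff i) := by
  let K := FractionRing R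
  let E := FractionRing A
  let : Algebra E K := FractionRing.liftAlgebra A K
  have : IsScalarTower A E K := FractionRing.isScalarTower_liftAlgebra A K
  have hlc : algebraMap A E p.leadingCoeff ≠ 0 := by
    simpa [IsFractionRing.to_map_eq_zero_iff] using hp
  -- Over the fraction field `p` becomes monic, and coefficients of monic divisors of monic
  -- polynomials are integral.
  have hpm : (p.map (algebraMap A E) * C (algebraMap A E p.leadingCoeff)⁻¹).Monic := by
    have hm : p.map (algebraMap A E) ≠ 0 :=
      (Polynomial.map_ne_zero_iff (IsFractionRing.injective A E)).2 hp
    have := monic_mul_leadingCoeff_inv hm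
    rwa [leadingCoeff_map_of_injective (IsFractionRing.injective A E)] at this
  have hd : h.map (algebraMap R K) ∣
      (p.map (algebraMap A E) * C (algebraMap A E p.leadingCoeff)⁻¹).map (algebraMap E K) := by
    rw [Polynomial.map_mul, Polynomial.map_map, ← IsScalarTower.algebraMap_eq,
      IsScalarTower.algebraMap_eq A R K, ← Polynomial.map_map]
    exact (Polynomial.map_dvd _ hdvd).mul_right _
  have hint := isIntegral_coeff_of_dvd _ _ hpm (hh.map (algebraMap R K)) hd i
  rw [coeff_map] at hint
  have halg : IsAlgebraic A (algebraMap R K (h.coeff i)) :=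
    (IsFractionRing.isAlgebraic_iff A E K).2 hint.isAlgebraic
  exact (isAlgebraic_algebraMap_iff (IsFractionRing.injective R K)).1 halg

/-- Incomparability: strict inclusions of primes stay strict after contraction along an integral
map. -/
theorem RingHom.IsIntegral.ringKrullDim_le {R S : Type*} [CommRing R] [CommRing S] {f : R →+* S}
    (hf : f.IsIntegral) : ringKrullDim S ≤ ringKrullDim R := by
  algebraize [f]
  refine Order.krullDim_le_of_strictMono (PrimeSpectrum.comap f) fun I J hIJ => ?_
  obtain ⟨hle, x, hxJ, hxI⟩ := SetLike.lt_iff_le_and_exists.1 (show I.asIdeal < J.asIdeal from hIJ)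
  exact Ideal.comap_lt_comap_of_integral_mem_sdiff (R := R) hle ⟨hxJ, hxI⟩ (hf x)

open Cardinal in
/-- A finitely generated algebra that embeds into a polynomial ring over a field has at most the
dimension of that polynomial ring. -/
theorem ringKrullDim_le_card_of_injective {F A σ : Type*} [Field F] [CommRing A]
    [Algebra F A] [Algebra.FiniteType F A] [Finite σ] (f : A →ₐ[F] MvPolynomial σ F)
    (hf : Function.Injective f) : ringKrullDim A ≤ (Nat.card σ : ℕ) := by
  have : Nontrivial A := f.toRingHom.domain_nontrivial
  obtain ⟨s, g, hg, hint⟩ := exists_integral_inj_algHom_of_fg F A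
  have hs : s ≤ Nat.card σ := by
    have h := lift_trdeg_le_of_injective (f.comp g) (hf.comp hg)
    rw [MvPolynomial.trdeg_of_isDomain, MvPolynomial.trdeg_of_isDomain] at h
    rw [← Nat.cast_card (α := σ)] at h
    simpa using h
  refine hint.ringKrullDim_le.trans ?_
  rw [MvPolynomial.ringKrullDim_of_isNoetherianRing, ringKrullDim_eq_zero_of_field]
  simpa using hs

/-! ### Chains of irreducible closed sets and chains of primes. -/

namespace DecomposablePolynomials

open MvPolynomial TopologicalSpace Order

section
variable {X τ F : Type*} [Field F]

/-- The topology on `X` induced from the Zariski topology by a map to affine space. -/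
abbrev inducedZariski (c : X → τ → F) : TopologicalSpace X :=
  TopologicalSpace.induced c (zariskiTopology τ F)

theorem isClosed_inducedZariski_iff {c : X → τ → F} {Z : Set X} :
    @IsClosed X (inducedZariski c) Z ↔ ∃ S, Z = c ⁻¹' zeroSet S := by
  let := zariskiTopology τ F
  rw [isClosed_induced_iff]
  have key : ∀ t : Set (τ → F), IsClosed t ↔ ∃ S, t = zeroSet S := fun t => by
    rw [← isOpen_compl_iff]
    change tᶜᶜ ∈ _ ↔ _
    rw [compl_compl]
    rfl
  constructor
  · rintro ⟨t, ht, rfl⟩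
    obtain ⟨S, rfl⟩ := (key t).1 ht
    exact ⟨S, rfl⟩
  · rintro ⟨S, rfl⟩
    exact ⟨_, (key _).2 ⟨S, rfl⟩, rfl⟩

/-- The ideal of the polynomials that vanish on the image of `Z`. -/
noncomputable abbrev idealOf (c : X → τ → F) (Z : Set X) : Ideal (MvPolynomial τ F) :=
  vanishingIdeal F (c '' Z)

theorem mem_idealOf {c : X → τ → F} {Z : Set X} {p : MvPolynomial τ F} :
    p ∈ idealOf c Z ↔ ∀ x ∈ Z, eval (c x) p = 0 := by
  simp [mem_vanishingIdeal_iff, MvPolynomial.aeval_eq_eval]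

theorem idealOf_anti (c : X → τ → F) : Antitone (idealOf c) := fun _ _ h =>
  vanishingIdeal_anti_mono (Set.image_mono h)

/-- A closed set is recovered from its ideal by construction of the topology, so no Nullstellensatz
is needed. -/
theorem mem_of_isClosed {c : X → τ → F} {Z : Set X} (hZ : @IsClosed X (inducedZariski c) Z) {x : X}
    (hx : ∀ p ∈ idealOf c Z, eval (c x) p = 0) : x ∈ Z := by
  obtain ⟨S, rfl⟩ := isClosed_inducedZariski_iff.1 hZ
  exact fun p hp => hx p (mem_idealOf.2 fun y hy => hy p hp)

theorem isPrime_idealOf_iff {c : X → τ → F} {Z : Set X} :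
    (idealOf c Z).IsPrime ↔ @IsIrreducible X (inducedZariski c) Z := by
  let := inducedZariski c
  constructor
  · intro hP
    refine ⟨?_, isPreirreducible_iff_isClosed_union_isClosed.2 fun A B hA hB hAB => ?_⟩
    · by_contra hne
      rw [Set.not_nonempty_iff_eq_empty] at hne
      exact hP.ne_top (by simp [idealOf, hne, vanishingIdeal_empty])
    · by_contra! hcon
      obtain ⟨⟨x, hxZ, hxA⟩, y, hyZ, hyB⟩ := hcon.imp Set.not_subset.1 Set.not_subset.1
      obtain ⟨S, rfl⟩ := isClosed_inducedZariski_iff.1 hA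
      obtain ⟨T, rfl⟩ := isClosed_inducedZariski_iff.1 hB
      simp only [zeroSet, Set.mem_preimage, Set.mem_ofPred_eq, not_forall] at hxA hyB
      obtain ⟨p, hp, hpx⟩ := hxA
      obtain ⟨q, hq, hqy⟩ := hyB
      have hpq : p * q ∈ idealOf c Z := mem_idealOf.2 fun z hz => by
        rcases hAB hz with h | h
        · simp [h p hp]
        · simp [h q hq]
      rcases hP.mem_or_mem hpq with h | h
      · exact hpx (mem_idealOf.1 h x hxZ)
      · exact hqy (mem_idealOf.1 h y hyZ)
  · rintro ⟨⟨x, hx⟩, hirr⟩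
    refine ⟨fun h => ?_, fun {p q} hpq => ?_⟩
    · have h1 : (1 : MvPolynomial τ F) ∈ idealOf c Z := h ▸ Submodule.mem_top
      simpa using mem_idealOf.1 h1 x hx
    · have hcl : ∀ r : MvPolynomial τ F, IsClosed (c ⁻¹' zeroSet {r}) := fun r =>
        isClosed_inducedZariski_iff.2 ⟨_, rfl⟩
      have := isPreirreducible_iff_isClosed_union_isClosed.1 hirr _ _ (hcl p) (hcl q)
        fun z hz => by simpa [zeroSet] using mem_idealOf.1 hpq z hz
      refine this.imp (fun h => mem_idealOf.2 fun z hz => ?_) fun h => mem_idealOf.2 fun z hz => ?_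
      · exact h hz p rfl
      · exact h hz q rfl

/-- If `X` is covered by finitely many closed sets whose defining ideals have coordinate rings of
dimension at most `n`, then `X` has dimension at most `n`. -/
theorem topologicalKrullDim_inducedZariski_le {ι : Type*} (s : Finset ι)
    (c : X → τ → F) (J : ι → Ideal (MvPolynomial τ F)) (n : WithBot ℕ∞)
    (hJ : ∀ x, ∃ i ∈ s, ∀ p ∈ J i, eval (c x) p = 0)
    (hn : ∀ i ∈ s, ringKrullDim (MvPolynomial τ F ⧸ J i) ≤ n) :
    @topologicalKrullDim X (inducedZariski c) ≤ n := by
  let := inducedZariski c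
  refine iSup_le fun p => ?_
  have hprime : ∀ Z : IrreducibleCloseds X, (idealOf c (Z : Set X)).IsPrime := fun Z =>
    isPrime_idealOf_iff.2 Z.isIrreducible
  obtain ⟨i, hi, hle⟩ : ∃ i ∈ s, J i ≤ idealOf c (p.last : Set X) := by
    -- The finite intersection of the `J i` vanishes on all of `X`, and a prime containing it
    -- contains some `J i`.
    refine (hprime p.last).inf_le'.1 fun q hq => mem_idealOf.2 fun x _ => ?_
    obtain ⟨i, hi, h⟩ := hJ x
    exact h q (Finset.inf_le (f := J) hi hq)
  refine le_trans ?_ (hn i hi)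
  rw [ringKrullDim_quotient]
  let l : LTSeries (PrimeSpectrum.zeroLocus (J i : Set (MvPolynomial τ F))) :=
    LTSeries.mk p.length
      (fun a => ⟨⟨idealOf c (p a.rev : Set X), hprime _⟩,
        hle.trans (idealOf_anti c (show p a.rev ≤ p.last from LTSeries.monotone p (Fin.le_last _)))⟩)
      (fun a b hab => by
        have hlt : p b.rev < p a.rev := p.strictMono (Fin.rev_lt_rev.2 hab)
        refine lt_of_le_not_ge (idealOf_anti c hlt.le) fun hge => hlt.not_ge fun x hx => ?_
        exact mem_of_isClosed (p b.rev).isClosed fun q hq => mem_idealOf.1 (hge hq) x hx)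
  exact LTSeries.length_le_krullDim l

/-- A chain of primes each of which is the ideal of its zero set in `X` bounds the dimension of `X`
from below. -/
theorem le_topologicalKrullDim_inducedZariski (c : X → τ → F) (n : ℕ)
    (Q : Fin (n + 1) → Ideal (MvPolynomial τ F)) (hQ : StrictAnti Q) (hprime : ∀ i, (Q i).IsPrime)
    (hI : ∀ i p, (∀ x, (∀ q ∈ Q i, eval (c x) q = 0) → eval (c x) p = 0) → p ∈ Q i) :
    (n : WithBot ℕ∞) ≤ @topologicalKrullDim X (inducedZariski c) := by
  let := inducedZariski c
  have hid : ∀ i, idealOf c (c ⁻¹' zeroSet (Q i : Set (MvPolynomial τ F))) = Q i := fun i =>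
    le_antisymm (fun p hp => hI i p fun x hx => mem_idealOf.1 hp x hx)
      fun p hp => mem_idealOf.2 fun x hx => hx p hp
  have hcl : ∀ i, IsClosed (c ⁻¹' zeroSet (Q i : Set (MvPolynomial τ F))) := fun i =>
    isClosed_inducedZariski_iff.2 ⟨_, rfl⟩
  let l : LTSeries (IrreducibleCloseds X) := LTSeries.mk n
    (fun i => ⟨c ⁻¹' zeroSet (Q i : Set (MvPolynomial τ F)),
      isPrime_idealOf_iff.1 ((hid i).symm ▸ hprime i), hcl i⟩)
    (fun i j hij => by
      refine lt_of_le_not_ge (fun x hx p hp => hx p ((hQ hij).le hp)) fun hge => ?_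
      have := idealOf_anti c (show c ⁻¹' zeroSet (Q j : Set (MvPolynomial τ F)) ⊆
        c ⁻¹' zeroSet (Q i : Set (MvPolynomial τ F)) from hge)
      rw [hid, hid] at this
      exact (hQ hij).not_ge this)
  exact LTSeries.length_le_krullDim l

end
end DecomposablePolynomials

/-! ### Dimension bounds from polynomial parametrizations. -/

namespace DecomposablePolynomials

open MvPolynomial TopologicalSpace Order

section
variable {X τ F : Type*} [Field F]

/-- If `X` is covered by the images of finitely many polynomial maps from affine spaces of dimension
at most `n`, then `X` has dimension at most `n`. -/
theorem topologicalKrullDim_le_of_param [Finite τ] {ι : Type*} (s : Finset ι) (c : X → τ → F)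
    (σ : ι → Type*) [∀ i, Finite (σ i)] (ψ : ∀ i, MvPolynomial τ F →ₐ[F] MvPolynomial (σ i) F)
    (n : ℕ) (hX : ∀ x, ∃ i ∈ s, ∃ u, ∀ p, eval (c x) p = eval u (ψ i p))
    (hn : ∀ i ∈ s, Nat.card (σ i) ≤ n) :
    @topologicalKrullDim X (inducedZariski c) ≤ (n : WithBot ℕ∞) := by
  refine topologicalKrullDim_inducedZariski_le s c (fun i => RingHom.ker (ψ i)) n (fun x => ?_)
    fun i hi => ?_
  · obtain ⟨i, hi, u, hu⟩ := hX x
    refine ⟨i, hi, fun p hp => ?_⟩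
    rw [hu, (RingHom.mem_ker).1 hp, map_zero]
  · exact (ringKrullDim_le_card_of_injective (Ideal.kerLiftAlg (ψ i))
      (Ideal.kerLiftAlg_injective _)).trans (by exact_mod_cast hn i hi)

/-- The substitution that fixes the variables of index below `i` and replaces the others by the
coordinates of `a`; its kernel is the ideal of a linear subspace through `a`. -/
noncomputable def freezeFrom {σ : Type*} {n : ℕ} (e : σ ≃ Fin n) (a : σ → F) (i : ℕ) :
    MvPolynomial σ F →ₐ[F] MvPolynomial σ F :=
  aeval fun j => if (e j : ℕ) < i then MvPolynomial.X j else C (a j)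

theorem eval_freezeFrom {σ : Type*} {n : ℕ} (e : σ ≃ Fin n) (a v : σ → F) (i : ℕ)
    (p : MvPolynomial σ F) :
    eval v (freezeFrom e a i p) = eval (fun j => if (e j : ℕ) < i then v j else a j) p := by
  rw [freezeFrom, ← aeval_eq_eval, ← aeval_eq_eval, ← AlgHom.coe_coe, ← AlgHom.coe_coe,
    ← AlgHom.comp_apply]
  congr 1
  ext j
  by_cases h : (e j : ℕ) < i <;> simp [h]

theorem eval_freezeFrom_self {σ : Type*} {n : ℕ} (e : σ ≃ Fin n) (a : σ → F) (i : ℕ)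
    (p : MvPolynomial σ F) : eval a (freezeFrom e a i p) = eval a p := by
  simp [eval_freezeFrom]

theorem freezeFrom_freezeFrom {σ : Type*} {n : ℕ} (e : σ ≃ Fin n) (a : σ → F) {i j : ℕ}
    (hij : i ≤ j) (p : MvPolynomial σ F) :
    freezeFrom e a i (freezeFrom e a j p) = freezeFrom e a i p := by
  rw [← AlgHom.comp_apply]
  congr 1
  ext1 m
  simp only [freezeFrom, AlgHom.comp_apply, aeval_X]
  split_ifs with h1 h2 h2
  · simp [h2]
  · simp [h2]
  · omega
  · simp [algebraMap_eq]

/-- If `ψ` is dual to a polynomial map that sends a nonempty open subset of an affine space into `X`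
and the coordinates of that space are algebraic over the range of `ψ`, then the dimension of `X` is
at least that of the affine space. -/
theorem le_topologicalKrullDim_of_param [Infinite F] {σ : Type*} [Finite σ] (c : X → τ → F)
    (ψ : MvPolynomial τ F →ₐ[F] MvPolynomial σ F) {s : MvPolynomial σ F} (hs : s ≠ 0)
    (hX : ∀ u, eval u s ≠ 0 → ∃ x, ∀ p, eval (c x) p = eval u (ψ p))
    (halg : ∀ j, IsAlgebraic ψ.range (MvPolynomial.X j : MvPolynomial σ F)) :
    (Nat.card σ : WithBot ℕ∞) ≤ @topologicalKrullDim X (inducedZariski c) := by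
  have := Fintype.ofFinite σ
  have e : σ ≃ Fin (Nat.card σ) := Finite.equivFin σ
  choose p hp0 hp using halg
  -- A general point: off `s = 0`, and where no algebraic relation for a coordinate loses its
  -- leading coefficient.
  obtain ⟨a, ha⟩ : ∃ a, eval a (s * ∏ j, ((p j).leadingCoeff : MvPolynomial σ F)) ≠ 0 := by
    by_contra! h
    have h0 : s * ∏ j, ((p j).leadingCoeff : MvPolynomial σ F) = 0 :=
      MvPolynomial.funext fun v => by rw [h v, map_zero]
    refine (mul_ne_zero hs (Finset.prod_ne_zero_iff.2 fun j _ => ?_)) h0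
    simpa using hp0 j
  rw [map_mul, map_prod, mul_ne_zero_iff, Finset.prod_ne_zero_iff] at ha
  obtain ⟨has, hap⟩ := ha
  let P : ℕ → Ideal (MvPolynomial σ F) := fun i => RingHom.ker (freezeFrom e a i)
  have hPmem : ∀ i t, t ∈ P i ↔ freezeFrom e a i t = 0 := fun i t => RingHom.mem_ker
  have hPa : ∀ i t, t ∈ P i → eval a t = 0 := fun i t ht => by
    rw [← eval_freezeFrom_self e a i, (hPmem i t).1 ht, map_zero]
  have hPprime : ∀ i, (P i).IsPrime := fun i => RingHom.ker_isPrime _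
  refine le_topologicalKrullDim_inducedZariski c _ (fun i => (P i).comap ψ)
    (Fin.strictAnti_iff_succ_lt.2 fun i => ?_) (fun i => (hPprime i).comap ψ) fun i t ht => ?_
  · have hle : P (i + 1) ≤ P i := fun t ht => by
      rw [hPmem] at ht ⊢
      rw [← freezeFrom_freezeFrom e a (Nat.le_succ i), ht, map_zero]
    have := hPprime (i + 1)
    let j := e.symm i
    have hj : e j = i := by simp [j]
    have hr : (MvPolynomial.X j - MvPolynomial.C (a j) : MvPolynomial σ F) ∈
        (P i : Set (MvPolynomial σ F)) \ P (i + 1) := by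
      refine ⟨(hPmem _ _).2 (by simp [freezeFrom, hj, algebraMap_eq]), fun h => ?_⟩
      have h1 := (hPmem _ _).1 h
      have h2 := congrArg (eval fun m => a m + 1) h1
      simp [freezeFrom, hj, algebraMap_eq] at h2
    -- The Taylor shift turns the relation for `X j` into one for `X j - a j`. Its leading
    -- coefficient is nonzero at `a`, so the relation survives modulo the contraction of `P (i +
    -- 1)`.
    have hlt := Ideal.comap_lt_comap_of_root_mem_sdiff (f := algebraMap ψ.range (MvPolynomial σ F))
      hle hr (p := Polynomial.taylor (algebraMap F ψ.range (a j)) (p j)) (fun h0 => by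
        have h1 := congrArg (fun q => q.coeff (p j).natDegree) h0
        simp only [Polynomial.coeff_map, Polynomial.coeff_zero, Polynomial.coeff_taylor_natDegree,
          Ideal.Quotient.eq_zero_iff_mem, Ideal.mem_comap] at h1
        exact hap j (Finset.mem_univ _) (hPa _ _ h1)) (by
        rw [Polynomial.taylor_apply, ← Polynomial.aeval_def, Polynomial.aeval_comp]
        have : Polynomial.aeval (MvPolynomial.X j - MvPolynomial.C (a j) : MvPolynomial σ F)
            (Polynomial.X + Polynomial.C (algebraMap F ψ.range (a j))) = MvPolynomial.X j := by
          rw [map_add, Polynomial.aeval_X, Polynomial.aeval_C, ← IsScalarTower.algebraMap_apply,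
            MvPolynomial.algebraMap_eq, sub_add_cancel]
        rw [this, hp j]
        exact Ideal.zero_mem _)
    obtain ⟨-, ⟨_, b, rfl⟩, hbi, hbs⟩ := SetLike.lt_iff_le_and_exists.1 hlt
    exact SetLike.lt_iff_le_and_exists.2 ⟨Ideal.comap_mono hle, b, hbi, hbs⟩
  · have hsi : freezeFrom e a i s ≠ 0 := fun h => has (hPa i s ((hPmem _ _).2 h))
    -- Points of `X` are only supplied off `s = 0`; multiplying by the restricted `s`, nonzero since
    -- `s` is nonzero at `a`, gives vanishing everywhere.
    refine (hPmem _ _).2 ((mul_eq_zero_iff_right hsi).1 (MvPolynomial.funext fun v => ?_))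
    rw [map_mul, map_zero, eval_freezeFrom e a v i s]
    by_cases hu : eval (fun j => if (e j : ℕ) < i then v j else a j) s = 0
    · rw [hu, mul_zero]
    · obtain ⟨x, hx⟩ := hX _ hu
      have h0 := ht x fun q hq => by
        rw [hx, ← eval_freezeFrom, (hPmem _ _).1 hq, map_zero]
      rw [hx, ← eval_freezeFrom] at h0
      exact mul_eq_zero_of_left h0 _

end
end DecomposablePolynomials

/-! ### Normalizing compositions and recovering their components. -/

namespace DecomposablePolynomials

open Polynomial

/-- If `g ∘ h` and the monic polynomial `h` of positive degree have coefficients in the range of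
`φ`, then so does `g`. -/
theorem mem_range_mapRingHom_of_comp {S R : Type*} [CommRing S] [CommRing R] (φ : S →+* R)
    {h : R[X]} (hm : h.Monic) (hd : h.natDegree ≠ 0) (hh : h ∈ (mapRingHom φ).range) (g : R[X])
    (hg : g.comp h ∈ (mapRingHom φ).range) : g ∈ (mapRingHom φ).range := by
  induction hn : g.natDegree using Nat.strong_induction_on generalizing g with
  | _ n ih =>
    subst hn
    -- As `h` is monic, the top coefficient of `g ∘ h` is that of `g`; its term can then be peeled
    -- off.
    have hlc : C g.leadingCoeff ∈ (mapRingHom φ).range := by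
      obtain ⟨q, hq⟩ := hg
      refine ⟨C (q.coeff (g.natDegree * h.natDegree)), ?_⟩
      rw [coe_mapRingHom] at hq ⊢
      rw [map_C, ← coeff_map, hq, coeff_comp_degree_mul_degree hd, hm.leadingCoeff, one_pow,
        mul_one]
    rcases eq_or_ne g.natDegree 0 with h0 | h0
    · rw [eq_C_of_natDegree_eq_zero h0]
      rwa [leadingCoeff, h0] at hlc
    · have hX : (X : R[X]) ∈ (mapRingHom φ).range := ⟨X, by simp⟩
      have hsum := eraseLead_add_C_mul_X_pow g
      rw [← hsum]
      refine add_mem (ih _ (by have := eraseLead_natDegree_le g; omega) _ ?_ rfl)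
        (mul_mem hlc (pow_mem hX _))
      rw [← hsum] at hg
      rw [add_comp, mul_comp, C_comp, X_pow_comp] at hg
      exact (add_mem_cancel_right (mul_mem hlc (pow_mem hh _))).1 hg

variable {R : Type*} [CommRing R] {d e k : ℕ}

/-- The polynomial `∑ aᵢ Xⁱ`. -/
noncomputable def outer (a : Fin (e + 1) → R) : R[X] := ∑ i, C (a i) * X ^ (i : ℕ)

/-- The polynomial `X ^ (k + 1) + ∑ bⱼ X ^ (j + 1)`. -/
noncomputable def inner (b : Fin k → R) : R[X] :=
  X ^ (k + 1) + ∑ j, C (b j) * X ^ ((j : ℕ) + 1)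

theorem coeff_outer (a : Fin (e + 1) → R) (i : Fin (e + 1)) : (outer a).coeff i = a i := by
  simp [outer, coeff_X_pow, Fin.val_inj]

theorem coeff_inner (b : Fin k → R) (j : Fin k) : (inner b).coeff (j + 1) = b j := by
  simp [inner, coeff_X_pow, Fin.val_inj, j.2.ne]

theorem coeff_zero_inner (b : Fin k → R) : (inner b).coeff 0 = 0 := by
  simp [inner]

theorem natDegree_outer_le (a : Fin (e + 1) → R) : (outer a).natDegree ≤ e :=
  natDegree_sum_le_of_forall_le _ _ fun i _ => (natDegree_C_mul_X_pow_le _ _).trans (by omega)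

theorem natDegree_outer {a : Fin (e + 1) → R} (ha : a (Fin.last e) ≠ 0) :
    (outer a).natDegree = e :=
  natDegree_eq_of_le_of_coeff_ne_zero (natDegree_outer_le a) ((coeff_outer a (Fin.last e)).trans_ne ha)

theorem degree_sum_lt (b : Fin k → R) :
    (∑ j, C (b j) * X ^ ((j : ℕ) + 1)).degree < ((k + 1 : ℕ) : WithBot ℕ) :=
  (degree_sum_le _ _).trans_lt ((Finset.sup_lt_iff (WithBot.bot_lt_coe _)).2 fun j _ =>
    (degree_C_mul_X_pow_le _ _).trans_lt (by exact_mod_cast Nat.succ_lt_succ j.2))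

theorem monic_inner (b : Fin k → R) : (inner b).Monic :=
  monic_X_pow_add (degree_sum_lt b)

theorem natDegree_inner [Nontrivial R] (b : Fin k → R) : (inner b).natDegree = k + 1 := by
  refine natDegree_eq_of_degree_eq_some ?_
  rw [inner, degree_add_eq_left_of_degree_lt] <;> rw [degree_X_pow]
  exact degree_sum_lt b

theorem map_outer {S : Type*} [CommRing S] (φ : R →+* S) (a : Fin (e + 1) → R) :
    (outer a).map φ = outer (φ ∘ a) := by
  simp [outer, Polynomial.map_sum]

theorem map_inner {S : Type*} [CommRing S] (φ : R →+* S) (b : Fin k → R) :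
    (inner b).map φ = inner (φ ∘ b) := by
  simp [inner, Polynomial.map_sum]

theorem eq_outer {g : R[X]} (hg : g.natDegree ≤ e) :
    g = outer fun i : Fin (e + 1) => g.coeff i := by
  conv_lhs => rw [as_sum_range_C_mul_X_pow' g (Nat.lt_succ_of_le hg)]
  rw [outer, Fin.sum_univ_eq_sum_range (fun i => C (g.coeff i) * X ^ i) (e + 1)]

theorem eq_inner {h : R[X]} (hm : h.Monic) (hd : h.natDegree = k + 1) (h0 : h.coeff 0 = 0) :
    h = inner fun j : Fin k => h.coeff (j + 1) := by
  conv_lhs => rw [hm.as_sum, hd, Finset.sum_range_succ']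
  rw [inner, Fin.sum_univ_eq_sum_range (fun i => C (h.coeff (i + 1)) * X ^ (i + 1)) k]
  simp [h0]

/-- Every composition over a field is a composition with a monic inner polynomial without constant
term. -/
theorem exists_comp_eq_outer_comp_inner {F : Type*} [Field F] {g h : F[X]}
    (hg : g.natDegree ≤ e) (hh : h.natDegree = k + 1) :
    ∃ (a : Fin (e + 1) → F) (b : Fin k → F), g.comp h = (outer a).comp (inner b) := by
  have hb : h.leadingCoeff ≠ 0 := by
    rw [Ne, leadingCoeff_eq_zero]
    rintro rfl
    simp at hh
  set L : F[X] := C h.leadingCoeff * X + C (h.coeff 0) with hL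
  set h' : F[X] := (h - C (h.coeff 0)) * C h.leadingCoeff⁻¹ with hh'
  have hcomp : L.comp h' = h := by
    have : C h.leadingCoeff * C h.leadingCoeff⁻¹ = (1 : F[X]) := by
      rw [← C_mul, mul_inv_cancel₀ hb, C_1]
    simp only [hL, hh', add_comp, mul_comp, C_comp, X_comp]
    linear_combination (h - C (h.coeff 0)) * this
  have hlead : (h - C (h.coeff 0)).leadingCoeff = h.leadingCoeff :=
    leadingCoeff_sub_of_degree_lt (degree_C_le.trans_lt (natDegree_pos_iff_degree_pos.1 (by omega)))
  have hm : h'.Monic := by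
    rw [hh', ← hlead]
    exact monic_mul_leadingCoeff_inv (by rwa [← leadingCoeff_ne_zero, hlead])
  have hd : h'.natDegree = k + 1 := by
    rw [hh', natDegree_mul_C (inv_ne_zero hb), natDegree_sub_C, hh]
  have h0 : h'.coeff 0 = 0 := by simp [hh']
  have hgL : (g.comp L).natDegree ≤ e := by
    refine natDegree_comp_le.trans ?_
    have : L.natDegree ≤ 1 := natDegree_linear_le
    nlinarith
  refine ⟨fun i => (g.comp L).coeff i, fun j => h'.coeff (j + 1), ?_⟩
  rw [← eq_outer hgL, ← eq_inner hm hd h0, comp_assoc, hcomp]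

/-- The coefficients of the components of a composition are algebraic over any subring that contains
the coefficients of the composition. -/
theorem isAlgebraic_of_coeff_comp_mem [IsDomain R] {A : Type*} [CommRing A] [IsDomain A]
    [Algebra A R] [FaithfulSMul A R] (he : e ≠ 0) (a : Fin (e + 1) → R) (b : Fin k → R)
    (ha : a (Fin.last e) ≠ 0)
    (hA : (outer a).comp (inner b) ∈ (mapRingHom (algebraMap A R)).range) :
    (∀ i, IsAlgebraic A (a i)) ∧ ∀ j, IsAlgebraic A (b j) := by
  have hcoeff : ∀ i, IsAlgebraic A ((inner b).coeff i) := by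
    obtain ⟨p, hp⟩ := hA
    rw [coe_mapRingHom] at hp
    -- Since `inner b` has no constant term, the constant term of the composition is that of `outer
    -- a`, and subtracting it makes `inner b` a divisor.
    refine isAlgebraic_coeff_of_dvd (p := p - C (p.coeff 0)) (fun h0 => ?_) (monic_inner b) ?_
    · have hdeg : ((outer a).comp (inner b)).natDegree = e * (k + 1) := by
        rw [natDegree_comp, natDegree_inner, natDegree_outer ha]
      rw [← hp, sub_eq_zero.1 h0, map_C, natDegree_C] at hdeg
      exact (Nat.mul_ne_zero he (Nat.succ_ne_zero k)) hdeg.symm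
    · rw [Polynomial.map_sub, map_C, ← coeff_map, hp]
      have h0 : ((outer a).comp (inner b)).coeff 0 = (outer a).coeff 0 := by
        rw [coeff_zero_eq_eval_zero, eval_comp, ← coeff_zero_eq_eval_zero (inner b),
          coeff_zero_inner, coeff_zero_eq_eval_zero]
      obtain ⟨q, hq⟩ := X_dvd_sub_C (p := outer a)
      refine ⟨q.comp (inner b), ?_⟩
      rw [h0, ← C_comp (p := inner b), ← sub_comp, hq, mul_comp, X_comp]
  refine ⟨fun i => ?_, fun j => coeff_inner b j ▸ hcoeff _⟩
  let S := Subalgebra.algebraicClosure A R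
  have hin : inner b ∈ (mapRingHom (algebraMap S R)).range :=
    ⟨inner fun j => ⟨b j, coeff_inner b j ▸ hcoeff _⟩, by
      rw [coe_mapRingHom, map_inner]
      rfl⟩
  have hA' : (outer a).comp (inner b) ∈ (mapRingHom (algebraMap S R)).range := by
    obtain ⟨p, hp⟩ := hA
    refine ⟨p.map (algebraMap A S), ?_⟩
    rw [coe_mapRingHom] at hp ⊢
    rw [Polynomial.map_map, ← IsScalarTower.algebraMap_eq, hp]
  obtain ⟨q, hq⟩ := mem_range_mapRingHom_of_comp _ (monic_inner b)
    (by rw [natDegree_inner]; omega) hin _ hA'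
  rw [← coeff_outer a i, ← hq, coe_mapRingHom, coeff_map]
  exact (q.coeff i).2

end DecomposablePolynomials

/-! ### The dimension of the set of decomposable polynomials. -/

namespace DecomposablePolynomials

open MvPolynomial

section
variable {F : Type*} [Field F]

/-- The homomorphism dual to the composition map on coefficient vectors: it sends the `m`-th
coordinate to the `m`-th coefficient of the composition of generic polynomials. -/
noncomputable def compHom (F : Type*) [Field F] (d e k : ℕ) :
    MvPolynomial (Fin (d + 1)) F →ₐ[F] MvPolynomial (Fin (e + 1) ⊕ Fin k) F :=
  aeval fun m => ((outer fun i => X (.inl i)).comp (inner fun j => X (.inr j))).coeff m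

theorem eval_compHom {d e k : ℕ} (u : Fin (e + 1) ⊕ Fin k → F)
    (p : MvPolynomial (Fin (d + 1)) F) :
    eval u (compHom F d e k p) =
      eval (fun m : Fin (d + 1) => ((outer (u ∘ Sum.inl)).comp (inner (u ∘ Sum.inr))).coeff m) p := by
  rw [compHom, ← aeval_eq_eval, ← aeval_eq_eval, ← AlgHom.coe_coe, ← AlgHom.coe_coe,
    ← AlgHom.comp_apply]
  congr 1
  ext m
  rw [AlgHom.comp_apply, aeval_X, AlgHom.coe_coe, AlgHom.coe_coe, aeval_X, aeval_eq_eval,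
    ← RingHom.coe_coe, ← Polynomial.coeff_map, Polynomial.map_comp, map_outer, map_inner]
  congr <;> ext i <;> simp

theorem zariskiDim_eq {d : ℕ} (D : Set (Polynomial.degreeLE F (d : WithBot ℕ))) :
    zariskiDim D =
      @topologicalKrullDim D (inducedZariski fun f : D => coeffVector d f.1) := by
  rw [zariskiDim, zariskiTopologyDegreeLE, induced_compose]

theorem add_div_le_minFac_add_div {d e k : ℕ} (he : 2 ≤ e) (hk : 2 ≤ k) (hd : d = e * k) :
    e + k ≤ d.minFac + d / d.minFac := by
  have hde : d.minFac ≤ e := Nat.minFac_le_of_dvd he ⟨k, hd⟩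
  have hdk : d.minFac ≤ k := Nat.minFac_le_of_dvd hk ⟨e, by rw [hd, mul_comm]⟩
  have hpos := d.minFac_pos
  have hmul : d.minFac * (d / d.minFac) = d := Nat.mul_div_cancel' d.minFac_dvd
  obtain ⟨x, hx⟩ := Nat.exists_eq_add_of_le hde
  obtain ⟨y, hy⟩ := Nat.exists_eq_add_of_le hdk
  -- After multiplication by `l = d.minFac`, the claim is `(e - l) * (k - l) ≥ 0`.
  refine Nat.le_of_mul_le_mul_left ?_ hpos
  rw [mul_add, mul_add, hmul]
  generalize d.minFac = l at *
  subst hx hy hd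
  nlinarith [Nat.zero_le (x * y)]

/-- An element of `D_d` is a composition with components of complementary degrees. -/
theorem exists_degrees_of_mem_decomposables {d : ℕ}
    {f : Polynomial.degreeLE F (d : WithBot ℕ)} (hf : f ∈ decomposables F d) :
    ∃ g h : Polynomial F, 2 ≤ g.natDegree ∧ 2 ≤ h.natDegree ∧ d = g.natDegree * h.natDegree ∧
      (f : Polynomial F) = g.comp h := by
  obtain ⟨hdeg, g, h, hg, hh, hfgh⟩ := hf
  refine ⟨g, h, hg, hh, ?_, hfgh⟩
  rw [← Polynomial.natDegree_comp, ← hfgh, Polynomial.natDegree_eq_of_degree_eq_some hdeg]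

theorem decomposables_eq_empty_of_prime {d : ℕ} (hd : d.Prime) : decomposables F d = ∅ := by
  refine Set.eq_empty_of_forall_notMem fun f hf => ?_
  obtain ⟨g, h, hg, hh, hgh, -⟩ := exists_degrees_of_mem_decomposables hf
  exact Nat.not_prime_mul (by omega) (by omega) (hgh ▸ hd)

theorem zariskiDim_decomposables_le (d : ℕ) :
    zariskiDim (decomposables F d) ≤ ((d.minFac + d / d.minFac : ℕ) : WithBot ℕ∞) := by
  rw [zariskiDim_eq]
  refine topologicalKrullDim_le_of_param
    (((Finset.range (d + 1)) ×ˢ (Finset.range (d + 1))).filter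
      fun i => 2 ≤ i.1 ∧ 1 ≤ i.2 ∧ d = i.1 * (i.2 + 1)) _
    (fun i => Fin (i.1 + 1) ⊕ Fin i.2) (fun i => compHom F d i.1 i.2) _ (fun f => ?_) fun i hi => ?_
  · obtain ⟨g, h, hg, hh, hgh, hfgh⟩ := exists_degrees_of_mem_decomposables f.2
    obtain ⟨k, hk⟩ : ∃ k, h.natDegree = k + 1 := ⟨h.natDegree - 1, by omega⟩
    obtain ⟨a, b, hab⟩ := exists_comp_eq_outer_comp_inner le_rfl hk (g := g)
    rw [hk] at hgh
    refine ⟨(g.natDegree, k), ?_, Sum.elim a b, fun p => ?_⟩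
    · simp only [Finset.mem_filter, Finset.mem_product, Finset.mem_range]
      exact ⟨⟨by nlinarith, by nlinarith⟩, hg, by omega, hgh⟩
    · rw [eval_compHom, Sum.elim_comp_inl, Sum.elim_comp_inr, ← hab, ← hfgh]
      rfl
  · obtain ⟨-, h1, h2, h3⟩ := Finset.mem_filter.1 hi
    have := add_div_le_minFac_add_div h1 (by omega) h3
    simp only [Nat.card_eq_fintype_card, Fintype.card_sum, Fintype.card_fin]
    omega

theorem le_zariskiDim_decomposables [Infinite F] {d e k : ℕ} (he : 2 ≤ e) (hk : 1 ≤ k)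
    (hd : d = e * (k + 1)) :
    ((e + (k + 1) : ℕ) : WithBot ℕ∞) ≤ zariskiDim (decomposables F d) := by
  rw [zariskiDim_eq]
  have hcard : e + (k + 1) = Nat.card (Fin (e + 1) ⊕ Fin k) := by
    simp only [Nat.card_eq_fintype_card, Fintype.card_sum, Fintype.card_fin]
    omega
  rw [hcard]
  let R := MvPolynomial (Fin (e + 1) ⊕ Fin k) F
  have hgen : (∀ i, IsAlgebraic (compHom F d e k).range (X (.inl i) : R)) ∧
      ∀ j, IsAlgebraic (compHom F d e k).range (X (.inr j) : R) := by
    refine isAlgebraic_of_coeff_comp_mem (by omega) _ _ (X_ne_zero _) ?_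
    rw [Polynomial.mem_map_range]
    intro m
    by_cases hm : m < d + 1
    · exact ⟨⟨_, X ⟨m, hm⟩, rfl⟩, aeval_X _ _⟩
    · refine ⟨0, ?_⟩
      rw [map_zero, Polynomial.coeff_eq_zero_of_natDegree_lt]
      rw [Polynomial.natDegree_comp, natDegree_inner]
      have := Nat.mul_le_mul_right (k + 1) (natDegree_outer_le
        fun i : Fin (e + 1) => (X (.inl i) : R))
      omega
  -- Where the top outer coefficient is nonzero, the composition has degree exactly `d`.
  refine le_topologicalKrullDim_of_param _ (compHom F d e k) (X_ne_zero (.inl (Fin.last e)))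
    (fun u hu => ?_) (Sum.forall.2 hgen)
  rw [eval_X] at hu
  have hg : (outer (u ∘ Sum.inl)).natDegree = e := natDegree_outer hu
  have hh : (inner (u ∘ Sum.inr)).natDegree = k + 1 := natDegree_inner _
  have hdeg : ((outer (u ∘ Sum.inl)).comp (inner (u ∘ Sum.inr))).natDegree = d := by
    rw [Polynomial.natDegree_comp, hg, hh, hd]
  have hne : (outer (u ∘ Sum.inl)).comp (inner (u ∘ Sum.inr)) ≠ 0 := fun h0 => by
    rw [h0, Polynomial.natDegree_zero] at hdeg
    exact Nat.mul_ne_zero (by omega) (Nat.succ_ne_zero k) (hd ▸ hdeg.symm)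
  have hdeg' := (Polynomial.degree_eq_iff_natDegree_eq hne).2 hdeg
  refine ⟨⟨⟨_, Polynomial.mem_degreeLE.2 hdeg'.le⟩, hdeg', _, _, ?_, ?_, rfl⟩, fun p => ?_⟩
  · omega
  · omega
  · rw [eval_compHom]
    rfl

end
end DecomposablePolynomials

theorem mainTheorem11 {F : Type*} [Field F] [IsAlgClosed F] (d : ℕ) (hd : 2 ≤ d) :
    (d.Prime → DecomposablePolynomials.decomposables F d = ∅) ∧
    (¬ d.Prime →
      DecomposablePolynomials.zariskiDim (DecomposablePolynomials.decomposables F d) =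
        ((d.minFac + d / d.minFac : ℕ) : WithBot ℕ∞)) := by
  refine ⟨DecomposablePolynomials.decomposables_eq_empty_of_prime, fun hp =>
    le_antisymm (DecomposablePolynomials.zariskiDim_decomposables_le d) ?_⟩
  have hmul : d.minFac * (d / d.minFac) = d := Nat.mul_div_cancel' d.minFac_dvd
  have hl : 2 ≤ d.minFac := (Nat.minFac_prime (by omega)).two_le
  -- Compositeness enters here: the cofactor is at least `2`, so it is an admissible inner degree.
  have hle : d.minFac ≤ d / d.minFac := Nat.minFac_le_div (by omega) hp
  obtain ⟨k, hk⟩ : ∃ k, d / d.minFac = k + 1 := ⟨d / d.minFac - 1, by omega⟩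
  rw [hk] at hmul hle ⊢
  exact DecomposablePolynomials.le_zariskiDim_decomposables hl (by omega) hmul.symm
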